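/- A clutter with finite vertex set $X$ is a family $E(C)$ of subsets of $X$, called edges, none of which is included in another. A vertex cover of $C$ is a set $W\subseteq X$ meeting every edge; it is minimal if no proper subset is a vertex cover. $C$ is well-covered if all its minimal vertex covers have the same cardinality, and very well-covered if moreover this cardinality is $\frac12|X|$. Let $\Bbbk$ be a field, and let $I(C)\subseteq\Bbbk[X]$ be the edge ideal of $C$, generated by the monomials $\prod_{x\in e}x$ with $e\in E(C)$; assigning to a clutter its edge ideal is a bijection between clutters on $X$ and squarefree monomial ideals of $\Bbbk[X]$. For $s\in\mathbb{N}=\{0,1,2,\dots\}$ and $W\subseteq X$ let $\mathcal{J}_s(W)=\{x_j : x\in W,\ 0\le j\le s\}$. For an ideal $I\subseteq\Bbbk[X]$ let $\mathcal{J}_s(I)\subseteq\Bbbk[\mathcal{J}_s(X)]$ be the ideal generated by the coefficients of $t^0,\dots,t^s$ in $\phi_s(f)$, $f\in I$, where $\phi_s$ is the homomorphism of $\Bbbk$-algebras with $\phi_s(x)=\sum_{j=0}^s x_jt^j$. Let $Z\subseteq\mathbb{A}^{|X|}_{\Bbbk}=\operatorname{Spec}\Bbbk[X]$ be the (reduced)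 vanishing locus of $I$, $Z_{\mathrm{sing}}$ the set of points where it is not smooth over $\Bbbk$, $\mathcal{J}_s(Z)$ the vanishing locus of $\mathcal{J}_s(\mathbb{I}(Z))$, and $\pi_s$ the projection $\operatorname{Spec}\Bbbk[\mathcal{J}_s(X)]\to\operatorname{Spec}\Bbbk[X]$ induced by $x\mapsto x_0$. The ideal of principal $s$-jets of $I$ is $$\mathcal{P}_s(I)=\mathbb{I}\left(\overline{\mathcal{J}_s(Z)\setminus\pi_s^{-1}(Z_{\mathrm{sing}})}\right).$$ Let $C$ be a clutter with finite vertex set $X$, and let $W_1,\dots,W_n$ be its minimal vertex covers. For every $s\in\mathbb{N}$, $\mathcal{P}_s(I(C))$ is the edge ideal of a (unique) clutter $\mathcal{P}_s(C)$ with vertex set $\mathcal{J}_s(X)$, the clutter of principal $s$-jets of $C$, and the minimal vertex covers of $\mathcal{P}_s(C)$ are exactly the sets $\mathcal{J}_s(W_1),\dots,\mathcal{J}_s(W_n)$. In particular, $C$ is well-covered if and only if $\mathcal{P}_s(C)$ is well-covered for every $s\in\mathbb{N}$, and $C$ is very well-covered if and only if $\mathcal{P}_s(C)$ is very well-covered for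 every $s\in\mathbb{N}$. The latter also holds if, for a fixed $d\in\mathbb{N}$, "very well-covered" is taken to mean that all edges have $d$ vertices, all minimal vertex covers have the same cardinality, and $d\,|W|=|X|$ for every minimal vertex cover $W$. -/

import Mathlib

/-- A clutter with vertex set `V`: a family of subsets of `V`, called edges, none of which is
included in another. -/
structure Clutter (V : Type*) where
  edges : Set (Finset V)
  isAntichain : IsAntichain (· ⊆ ·) edges

namespace Clutter

variable {V : Type*}

/-- `W` meets every edge. -/
def IsVertexCover (C : Clutter V) (W : Finset V) : Prop :=
  ∀ e ∈ C.edges, ∃ x ∈ e, x ∈ W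

/-- A vertex cover no proper subset of which is a vertex cover. -/
def IsMinimalVertexCover (C : Clutter V) (W : Finset V) : Prop :=
  Minimal C.IsVertexCover W

/-- All minimal vertex covers have the same cardinality. -/
def IsWellCovered (C : Clutter V) : Prop :=
  ∀ W W', C.IsMinimalVertexCover W → C.IsMinimalVertexCover W' → W.card = W'.card

/-- Well-covered, and the common cardinality of the minimal vertex covers is half the number of
vertices. -/
def IsVeryWellCovered [Fintype V] (C : Clutter V) : Prop :=
  C.IsWellCovered ∧ ∀ W, C.IsMinimalVertexCover W → 2 * W.card = Fintype.card V

/-- All edges have `d` vertices. -/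
def IsUniform (C : Clutter V) (d : ℕ) : Prop :=
  ∀ e ∈ C.edges, e.card = d

/-- The analogue of "very well-covered" for `d`-uniform clutters: every minimal vertex cover
contains exactly a fraction `1 / d` of the vertices. -/
def IsUniformVeryWellCovered [Fintype V] (C : Clutter V) (d : ℕ) : Prop :=
  C.IsUniform d ∧ C.IsWellCovered ∧
    ∀ W, C.IsMinimalVertexCover W → d * W.card = Fintype.card V

/-- The edge ideal `I(C)` in `k[V]`, generated by the monomials `∏ x ∈ e, x`, for `e` an edge. -/
noncomputable def edgeIdeal (k : Type*) [Field k] (C : Clutter V) : Ideal (MvPolynomial V k) :=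
  Ideal.span ((fun e : Finset V => ∏ x ∈ e, MvPolynomial.X x) '' C.edges)

/-- The clutter whose edges are the supports of the minimal squarefree monomials in `I`. If `I`
is a squarefree monomial ideal, this is the unique clutter with edge ideal `I`. -/
def ofIdeal {k : Type*} [Field k] (I : Ideal (MvPolynomial V k)) : Clutter V where
  edges := {e | Minimal (fun e : Finset V => ∏ x ∈ e, (MvPolynomial.X x : MvPolynomial V k) ∈ I) e}
  isAntichain := fun _ he _ hf hne hle => hne (le_antisymm hle (hf.2 he.1 hle))

theorem prod_mem_edgeIdeal (k : Type*) [Field k] (C : Clutter V) (e : Finset V) :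
    ∏ x ∈ e, MvPolynomial.X x ∈ C.edgeIdeal k ↔ ∃ f ∈ C.edges, f ⊆ e := by
  classical
  have key (f : Finset V) : ∏ x ∈ f, (MvPolynomial.X x : MvPolynomial V k) =
      MvPolynomial.monomial (∑ x ∈ f, Finsupp.single x 1) 1 := by
    simp [MvPolynomial.monomial_sum_one, MvPolynomial.X]
  have hs (f : Finset V) (y : V) :
      (∑ x ∈ f, Finsupp.single x 1 : V →₀ ℕ) y = if y ∈ f then 1 else 0 := by
    simp [Finsupp.finsetSum_apply, Finsupp.single_apply]
  have himg : (fun f : Finset V => ∏ x ∈ f, (MvPolynomial.X x : MvPolynomial V k)) '' C.edges =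
      (fun m => MvPolynomial.monomial m (1 : k)) ''
        ((fun f : Finset V => (∑ x ∈ f, Finsupp.single x 1 : V →₀ ℕ)) '' C.edges) := by
    rw [Set.image_image]; simp only [key]
  rw [edgeIdeal, himg, MvPolynomial.mem_ideal_span_monomial_image, key]
  simp only [MvPolynomial.support_monomial, one_ne_zero, if_false, Finset.mem_singleton,
    forall_eq, Set.exists_mem_image]
  refine exists_congr fun f => and_congr_right fun _ => ⟨fun h x hx => ?_, fun h x => ?_⟩
  · have := h x
    rw [hs, hs, if_pos hx] at this
    by_contra hxe
    simp [hxe] at this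
  · rw [hs, hs]
    by_cases hx : x ∈ f
    · simp [hx, h hx]
    · simp [hx]

/-- A clutter is determined by its edge ideal, and `ofIdeal` recovers it. -/
theorem ofIdeal_edgeIdeal (k : Type*) [Field k] (C : Clutter V) :
    ofIdeal (C.edgeIdeal k) = C := by
  obtain ⟨E, hE⟩ := C
  simp only [ofIdeal, Clutter.mk.injEq, prod_mem_edgeIdeal]
  ext e
  constructor
  · rintro ⟨⟨f, hf, hfe⟩, hmin⟩
    have : e ⊆ f := hmin ⟨f, hf, le_rfl⟩ hfe
    rwa [← Finset.Subset.antisymm hfe this]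
  · refine fun he => ⟨⟨e, he, le_rfl⟩, ?_⟩
    rintro g ⟨f, hf, hfg⟩ hge
    have : f = e := hE.eq hf he (hfg.trans hge)
    exact this ▸ hfg

end Clutter

namespace Jets

open MvPolynomial

variable {V k : Type*} [Field k]

/-- `J_s(W)`, the set of all `x_j` with `x ∈ W` and `0 ≤ j ≤ s`. Here `x_j` is the pair `(x, j)`,
so that `J_s` of the whole vertex set `V` is the type `V × Fin (s + 1)`. -/
def jetSet (s : ℕ) (W : Finset V) : Finset (V × Fin (s + 1)) :=
  W ×ˢ Finset.univ

/-- The homomorphism `φ_s` with `φ_s(x) = ∑_{j ≤ s} x_j t^j`. It takes values in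
`k[J_s(V)][t]`; the quotient by `t^(s+1)` is accounted for by only ever using the coefficients
of `t^0, …, t^s`. -/
noncomputable def jetHom (k V : Type*) [Field k] (s : ℕ) :
    MvPolynomial V k →ₐ[k] Polynomial (MvPolynomial (V × Fin (s + 1)) k) :=
  aeval fun x => ∑ j : Fin (s + 1), Polynomial.C (X (x, j)) * Polynomial.X ^ (j : ℕ)

/-- The ideal of `s`-jets `J_s(I)`, generated by the coefficients of `t^0, …, t^s` in `φ_s(f)`.
Letting `f` run over `I` or over a set of generators of `I` gives the same ideal. -/
noncomputable def jetIdeal (s : ℕ) (I : Ideal (MvPolynomial V k)) :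
    Ideal (MvPolynomial (V × Fin (s + 1)) k) :=
  Ideal.span {g | ∃ f ∈ I, ∃ j ≤ s, g = (jetHom k V s f).coeff j}

/-- The inclusion `ι_s` of `k[V]` in `k[J_s(V)]` with `x ↦ x_0`. -/
noncomputable def jetInclusion (k V : Type*) [Field k] (s : ℕ) :
    MvPolynomial V k →ₐ[k] MvPolynomial (V × Fin (s + 1)) k :=
  rename fun x => (x, 0)

/-- The projection `π_s` from the jets of affine space to affine space. Affine space over `k` is
the spectrum of the polynomial ring. -/
noncomputable def jetProj (k V : Type*) [Field k] (s : ℕ) :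
    PrimeSpectrum (MvPolynomial (V × Fin (s + 1)) k) → PrimeSpectrum (MvPolynomial V k) :=
  PrimeSpectrum.comap (jetInclusion k V s : MvPolynomial V k →+* _)

/-- `J_s(Z)`, the space of `s`-jets of the (reduced) subvariety `Z` of affine space. -/
noncomputable def jetLocus (s : ℕ) (Z : Set (PrimeSpectrum (MvPolynomial V k))) :
    Set (PrimeSpectrum (MvPolynomial (V × Fin (s + 1)) k)) :=
  PrimeSpectrum.zeroLocus (jetIdeal s (PrimeSpectrum.vanishingIdeal Z))

/-- The points of the closed subscheme of affine space with coordinate ring `k[V] / J` at which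
it is not smooth over `k`. -/
noncomputable def nonsmoothPoints (J : Ideal (MvPolynomial V k)) :
    Set (PrimeSpectrum (MvPolynomial V k)) :=
  PrimeSpectrum.comap (Ideal.Quotient.mk J) '' (Algebra.smoothLocus k (MvPolynomial V k ⧸ J))ᶜ

/-- The singular locus of the (reduced) subvariety `Z` of affine space, whose coordinate ring is
`k[V] / 𝕀(Z)`. -/
noncomputable def singularLocus (Z : Set (PrimeSpectrum (MvPolynomial V k))) :
    Set (PrimeSpectrum (MvPolynomial V k)) :=
  nonsmoothPoints (PrimeSpectrum.vanishingIdeal Z)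

/-- The ideal of principal `s`-jets `P_s(I)`: the ideal of the Zariski closure of the set of
`s`-jets of the vanishing locus of `I` that are supported over its smooth locus. -/
noncomputable def principalJetIdeal (s : ℕ) (I : Ideal (MvPolynomial V k)) :
    Ideal (MvPolynomial (V × Fin (s + 1)) k) :=
  let Z : Set (PrimeSpectrum (MvPolynomial V k)) := PrimeSpectrum.zeroLocus I
  PrimeSpectrum.vanishingIdeal
    (closure (jetLocus s Z \ jetProj k V s ⁻¹' singularLocus Z))

end Jets

/-- The clutter `P_s(C)` of principal `s`-jets of `C`: the clutter with vertex set `J_s(V)` whose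
edge ideal is `P_s(I(C))`. -/
noncomputable def Clutter.principalJets (k : Type*) [Field k] {V : Type*} (s : ℕ)
    (C : Clutter V) : Clutter (V × Fin (s + 1)) :=
  Clutter.ofIdeal (Jets.principalJetIdeal s (C.edgeIdeal k))

/-! Everything follows from the equality of `P_s(I(C))` with the intersection of the primes
`varIdeal k (jetSet s W)`, `W` a minimal vertex cover of `C`. This intersection is the edge ideal of
`jetLift s C`, whose covers are computed by pure combinatorics. Since `P_s` is the intersection of
all primes `Q` in the jet locus lying over smooth points, there are two inclusions to check.

`principalJetIdeal ≤ edgeIdeal`: for each minimal cover `W` the prime of `jetSet s W` is such a `Q`.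
It lies over the generic point of a component of `Z`, near which `I(C)` agrees with a coordinate
subspace, so `Z` is smooth there (`isSmoothAt_of_comap_eq_varIdeal`).

`edgeIdeal ≤ principalJetIdeal`: let `Q` lie over a smooth point `P`. The crux,
`exists_edge_of_isSmoothAt`, is that every edge contains some `x ∈ P` which is the only vertex in
`P` of some edge. Otherwise a truncated arc through `P` would have no lift to the next order,
against formal smoothness. For such `x`, a product of `x` with a function invertible at `P` lies in
`I(C)`, which forces every `x_j` into `Q` (`X_mem_of_X_mul_mem`). These `x` form a vertex cover, so
`Q` contains the prime of some minimal cover. -/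

namespace Clutter

/-! ### Minimal vertex covers -/

section Covers

variable {V : Type*}

theorem IsVertexCover.mono {C : Clutter V} {W U : Finset V} (hW : C.IsVertexCover W)
    (h : W ⊆ U) : C.IsVertexCover U := fun e he =>
  let ⟨x, hx, hxW⟩ := hW e he
  ⟨x, hx, h hxW⟩

theorem IsVertexCover.exists_isMinimalVertexCover_subset {C : Clutter V} {W : Finset V}
    (hW : C.IsVertexCover W) : ∃ U ⊆ W, C.IsMinimalVertexCover U :=
  exists_minimal_le_of_wellFoundedLT C.IsVertexCover W hW

/-- Every vertex of a minimal vertex cover is the only one that meets some edge. -/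
theorem IsMinimalVertexCover.exists_edge {C : Clutter V} {W : Finset V}
    (hW : C.IsMinimalVertexCover W) {x : V} (hx : x ∈ W) :
    ∃ e ∈ C.edges, x ∈ e ∧ ∀ y ∈ e, y ∈ W → y = x := by
  classical
  by_contra! h
  have hcov : C.IsVertexCover (W.erase x) := by
    intro e he
    obtain ⟨y, hy, hyW⟩ := hW.1 e he
    by_cases hyx : y = x
    · obtain ⟨z, hz, hzW, hzx⟩ := h e he (hyx ▸ hy)
      exact ⟨z, hz, Finset.mem_erase.2 ⟨hzx, hzW⟩⟩
    · exact ⟨y, hy, Finset.mem_erase.2 ⟨hyx, hyW⟩⟩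
  exact Finset.notMem_erase x W (hW.2 hcov (Finset.erase_subset x W) hx)

end Covers

open MvPolynomial

/-! ### Primes generated by variables -/

section VarIdeal

variable {V : Type*} (k : Type*) [Field k]

/-- The ideal generated by the variables in `W`. -/
noncomputable def varIdeal (W : Finset V) : Ideal (MvPolynomial V k) :=
  Ideal.span (X '' (W : Set V))

variable {k}

theorem mem_varIdeal {W : Finset V} {f : MvPolynomial V k} :
    f ∈ varIdeal k W ↔ ∀ m ∈ f.support, ∃ x ∈ W, m x ≠ 0 :=
  mem_ideal_span_X_image

theorem X_mem_varIdeal {W : Finset V} {x : V} :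
    (X x : MvPolynomial V k) ∈ varIdeal k W ↔ x ∈ W := by
  classical
  simp [mem_varIdeal, X, support_monomial, Finsupp.single_apply]

theorem varIdeal_le_iff {W : Finset V} {I : Ideal (MvPolynomial V k)} :
    varIdeal k W ≤ I ↔ ∀ x ∈ W, X x ∈ I := by
  simp [varIdeal, Ideal.span_le, Set.subset_def]

/-- Setting the variables in `W` to zero. -/
noncomputable def killVars (k : Type*) [Field k] (W : Finset V) :
    MvPolynomial V k →ₐ[k] MvPolynomial {x // x ∉ W} k :=
  killCompl Subtype.val_injective

theorem killVars_X_eq_zero {W : Finset V} {x : V} (hx : x ∈ W) : killVars k W (X x) = 0 := by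
  simp [killVars, killCompl, hx]

theorem sub_rename_killVars_mem (W : Finset V) (f : MvPolynomial V k) :
    f - rename Subtype.val (killVars k W f) ∈ varIdeal k W := by
  rw [← Ideal.Quotient.eq]
  -- Both sides are algebra maps, so it suffices to compare them on variables.
  suffices h : Ideal.Quotient.mkₐ k (varIdeal k W) =
      ((Ideal.Quotient.mkₐ k (varIdeal k W)).comp (rename Subtype.val)).comp (killVars k W) from
    DFunLike.congr_fun h f
  refine algHom_ext fun x => ?_
  by_cases hx : x ∈ W
  · simpa [killVars_X_eq_zero hx] using Ideal.Quotient.eq_zero_iff_mem.2 (X_mem_varIdeal.2 hx)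
  · have := killCompl_rename_app (R := k) (Subtype.val_injective (p := fun x => x ∉ W)) (X ⟨x, hx⟩)
    simp only [rename_X] at this
    simp [killVars, this]

theorem ker_killVars (W : Finset V) : RingHom.ker (killVars k W) = varIdeal k W := by
  refine le_antisymm (fun f hf => ?_) (varIdeal_le_iff.2 fun x hx => killVars_X_eq_zero hx)
  have := sub_rename_killVars_mem W f
  rwa [RingHom.mem_ker.1 hf, map_zero, sub_zero] at this

instance varIdeal_isPrime (W : Finset V) : (varIdeal k W).IsPrime :=
  ker_killVars (k := k) W ▸ RingHom.ker_isPrime _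

end VarIdeal

/-! ### Edge ideals and their prime decomposition -/

section EdgeIdeal

variable {V : Type*} (k : Type*) [Field k]

theorem prod_X_eq_monomial [DecidableEq V] (e : Finset V) :
    ∏ x ∈ e, (X x : MvPolynomial V k) = monomial (∑ x ∈ e, Finsupp.single x 1) 1 := by
  simp [monomial_sum_one, X]

theorem mem_edgeIdeal (C : Clutter V) {f : MvPolynomial V k} :
    f ∈ C.edgeIdeal k ↔ ∀ m ∈ f.support, ∃ e ∈ C.edges, e ⊆ m.support := by
  classical
  have himg : (fun e : Finset V => ∏ x ∈ e, (X x : MvPolynomial V k)) '' C.edges =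
      (fun m => monomial m (1 : k)) ''
        ((fun e : Finset V => (∑ x ∈ e, Finsupp.single x 1 : V →₀ ℕ)) '' C.edges) := by
    rw [Set.image_image]
    simp only [prod_X_eq_monomial]
  rw [edgeIdeal, himg, mem_ideal_span_monomial_image]
  simp only [Set.exists_mem_image]
  refine forall₂_congr fun m _ => exists_congr fun e => and_congr_right fun _ => ?_
  simp only [Finsupp.le_def, Finsupp.finsetSum_apply, Finsupp.single_apply, Finset.sum_ite_eq',
    Finset.subset_iff, Finsupp.mem_support_iff]
  refine forall_congr' fun x => ?_
  split_ifs with hx <;> simp [hx, Nat.one_le_iff_ne_zero]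

theorem edgeIdeal_le_varIdeal_iff {C : Clutter V} {W : Finset V} :
    C.edgeIdeal k ≤ varIdeal k W ↔ C.IsVertexCover W := by
  rw [edgeIdeal, Ideal.span_le, Set.image_subset_iff]
  refine forall₂_congr fun e _ => ?_
  simp [(varIdeal_isPrime W).prod_mem_iff, X_mem_varIdeal]

/-- The prime decomposition of an edge ideal. -/
theorem edgeIdeal_eq_iInf [Finite V] (C : Clutter V) :
    C.edgeIdeal k = ⨅ (W : Finset V) (_ : C.IsMinimalVertexCover W), varIdeal k W := by
  classical
  have := Fintype.ofFinite V
  refine le_antisymm (le_iInf₂ fun W hW => (edgeIdeal_le_varIdeal_iff k).2 hW.1) fun f hf => ?_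
  simp only [Submodule.mem_iInf] at hf
  rw [mem_edgeIdeal]
  intro m hm
  by_contra! h
  -- If no edge lies in the support of `m`, the complement of the support is a cover, and the prime
  -- of a minimal cover inside it does not contain `m`.
  have hcov : C.IsVertexCover (m.supportᶜ) := by
    intro e he
    obtain ⟨x, hx, hxm⟩ := Finset.not_subset.1 (h e he)
    exact ⟨x, hx, Finset.mem_compl.2 hxm⟩
  obtain ⟨W, hWm, hW⟩ := hcov.exists_isMinimalVertexCover_subset
  obtain ⟨x, hx, hmx⟩ := mem_varIdeal.1 (hf W hW) m hm
  exact Finset.mem_compl.1 (hWm hx) (Finsupp.mem_support_iff.2 hmx)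

theorem edgeIdeal_isRadical [Finite V] (C : Clutter V) : (C.edgeIdeal k).IsRadical := by
  rw [edgeIdeal_eq_iInf]
  exact Ideal.isRadical_iInf _ fun W => Ideal.isRadical_iInf _ fun _ =>
    (varIdeal_isPrime W).isRadical

/-- By radicality, the reduced locus in the definition of principal jets has `I(C)` itself as its
ideal. -/
theorem vanishingIdeal_zeroLocus_edgeIdeal [Finite V] (C : Clutter V) :
    PrimeSpectrum.vanishingIdeal (PrimeSpectrum.zeroLocus (C.edgeIdeal k)) = C.edgeIdeal k := by
  rw [PrimeSpectrum.vanishingIdeal_zeroLocus_eq_radical, (edgeIdeal_isRadical k C).radical]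

/-- If `x` is the only vertex of an edge in a set `A`, and `A` consists of the variables in a
prime `P`, then a multiple of `x` by a polynomial outside `P` lies in the edge ideal. -/
theorem exists_X_mul_mem_edgeIdeal {C : Clutter V} {P : Ideal (MvPolynomial V k)} [P.IsPrime]
    {e : Finset V} (he : e ∈ C.edges) {x : V} (hx : x ∈ e) (h : ∀ y ∈ e, X y ∈ P → y = x) :
    ∃ g ∉ P, X x * g ∈ C.edgeIdeal k := by
  classical
  refine ⟨∏ y ∈ e.erase x, X y, ?_, ?_⟩
  · rw [‹P.IsPrime›.prod_mem_iff]
    rintro ⟨y, hy, hyP⟩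
    exact Finset.ne_of_mem_erase hy (h y (Finset.mem_of_mem_erase hy) hyP)
  · rw [Finset.mul_prod_erase e X hx]
    exact Ideal.subset_span ⟨e, he, rfl⟩

end EdgeIdeal

/-! ### Combinatorics of the lifted clutter -/

section Jets

variable {V : Type*}

open Classical in
/-- The clutter on `J_s(V)` whose edges are the lifts of the edges of `C`. -/
noncomputable def jetLift (s : ℕ) (C : Clutter V) : Clutter (V × Fin (s + 1)) where
  edges := {e | e.image Prod.fst ∈ C.edges ∧ Set.InjOn Prod.fst (e : Set (V × Fin (s + 1)))}
  isAntichain := by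
    intro e he f hf hne hle
    -- Nested lifts project to nested edges, hence to the same edge; injectivity of the projection
    -- then makes their cardinalities equal.
    have h := C.isAntichain.eq he.1 hf.1 (Finset.image_subset_image hle)
    refine hne (Finset.eq_of_subset_of_card_le hle ?_)
    rw [← Finset.card_image_of_injOn he.2, h, Finset.card_image_of_injOn hf.2]

theorem map_section_mem_jetLift_edges {s : ℕ} {C : Clutter V} {e : Finset V} (he : e ∈ C.edges)
    (j : V → Fin (s + 1)) :
    e.map ⟨fun x => (x, j x), fun _ _ h => congrArg Prod.fst h⟩ ∈ (C.jetLift s).edges := by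
  classical
  refine ⟨?_, ?_⟩
  · convert he
    rw [Finset.map_eq_image, Finset.image_image]
    exact Finset.image_id
  · intro a ha b hb hab
    simp only [Finset.coe_map, Set.mem_image, Finset.mem_coe] at ha hb
    obtain ⟨x, -, rfl⟩ := ha
    obtain ⟨y, -, rfl⟩ := hb
    obtain rfl : x = y := hab
    rfl

theorem isUniform_jetLift_iff {s : ℕ} {C : Clutter V} {d : ℕ} :
    (C.jetLift s).IsUniform d ↔ C.IsUniform d := by
  classical
  refine ⟨fun h e he => ?_, fun h e he => ?_⟩
  · rw [← h _ (map_section_mem_jetLift_edges he fun _ => 0), Finset.card_map]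
  · rw [← h _ he.1, Finset.card_image_of_injOn he.2]

theorem jetSet_subset_jetSet_iff {s : ℕ} {W U : Finset V} :
    Jets.jetSet s W ⊆ Jets.jetSet s U ↔ W ⊆ U :=
  ⟨fun h x hx => (Finset.mem_product.1
    (@h (x, (0 : Fin (s + 1))) (Finset.mem_product.2 ⟨hx, Finset.mem_univ _⟩))).1,
    fun h => Finset.product_subset_product_left h⟩

theorem card_jetSet (s : ℕ) (W : Finset V) : (Jets.jetSet s W).card = W.card * (s + 1) := by
  simp [Jets.jetSet]

/-- The witness `W` consists of the vertices whose whole fibre lies in `U`. An edge missing `W`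
would have, above each of its vertices, a level outside `U`, and these levels form a lifted edge
missing `U`. -/
theorem isVertexCover_jetLift_iff {s : ℕ} {C : Clutter V} {U : Finset (V × Fin (s + 1))} :
    (C.jetLift s).IsVertexCover U ↔ ∃ W, C.IsVertexCover W ∧ Jets.jetSet s W ⊆ U := by
  classical
  constructor
  · intro hU
    refine ⟨(U.image Prod.fst).filter fun x => ∀ j, (x, j) ∈ U, fun e he => ?_, ?_⟩
    · by_contra! h
      have hj (x : V) : ∃ j, x ∈ e → (x, j) ∉ U := by
        by_contra! hx
        exact h x (hx 0).1 (Finset.mem_filter.2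
          ⟨Finset.mem_image_of_mem Prod.fst (hx 0).2, fun j => (hx j).2⟩)
      choose j hj using hj
      obtain ⟨a, ha, haU⟩ := hU _ (map_section_mem_jetLift_edges he j)
      obtain ⟨x, hx, rfl⟩ := Finset.mem_map.1 ha
      exact hj x hx haU
    · rintro ⟨x, j⟩ h
      exact (Finset.mem_filter.1 (Finset.mem_product.1 h).1).2 j
  · rintro ⟨W, hW, hWU⟩ e he
    obtain ⟨x, hx, hxW⟩ := hW _ he.1
    obtain ⟨a, ha, rfl⟩ := Finset.mem_image.1 hx
    exact ⟨a, ha, hWU (Finset.mem_product.2 ⟨hxW, Finset.mem_univ _⟩)⟩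

theorem isVertexCover_jetLift_jetSet_iff {s : ℕ} {C : Clutter V} {W : Finset V} :
    (C.jetLift s).IsVertexCover (Jets.jetSet s W) ↔ C.IsVertexCover W := by
  simp only [isVertexCover_jetLift_iff, jetSet_subset_jetSet_iff]
  exact ⟨fun ⟨_, h, hle⟩ => h.mono hle, fun h => ⟨W, h, subset_rfl⟩⟩

theorem isMinimalVertexCover_jetLift_jetSet {s : ℕ} {C : Clutter V} {W : Finset V} :
    (C.jetLift s).IsMinimalVertexCover (Jets.jetSet s W) ↔ C.IsMinimalVertexCover W := by
  refine ⟨fun h => ⟨isVertexCover_jetLift_jetSet_iff.1 h.1, fun U hU hUW => ?_⟩,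
    fun h => ⟨isVertexCover_jetLift_jetSet_iff.2 h.1, fun U hU hUW => ?_⟩⟩
  · exact jetSet_subset_jetSet_iff.1
      (h.2 (isVertexCover_jetLift_jetSet_iff.2 hU) (jetSet_subset_jetSet_iff.2 hUW))
  · obtain ⟨W', hW', hle⟩ := isVertexCover_jetLift_iff.1 hU
    exact (jetSet_subset_jetSet_iff.2
      (h.2 hW' (jetSet_subset_jetSet_iff.1 (hle.trans hUW)))).trans hle

theorem setOf_isMinimalVertexCover_jetLift (s : ℕ) (C : Clutter V) :
    {U | (C.jetLift s).IsMinimalVertexCover U} =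
      Jets.jetSet s '' {W | C.IsMinimalVertexCover W} := by
  ext U
  constructor
  · intro hU
    obtain ⟨W, hW, hle⟩ := isVertexCover_jetLift_iff.1 hU.1
    obtain rfl := Finset.Subset.antisymm (hU.2 (isVertexCover_jetLift_jetSet_iff.2 hW) hle) hle
    exact ⟨W, isMinimalVertexCover_jetLift_jetSet.1 hU, rfl⟩
  · rintro ⟨W, hW, rfl⟩
    exact isMinimalVertexCover_jetLift_jetSet.2 hW

theorem isMinimalVertexCover_jetLift_iff {s : ℕ} {C : Clutter V} {U : Finset (V × Fin (s + 1))} :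
    (C.jetLift s).IsMinimalVertexCover U ↔ ∃ W, C.IsMinimalVertexCover W ∧ Jets.jetSet s W = U :=
  Set.ext_iff.1 (setOf_isMinimalVertexCover_jetLift s C) U

theorem isWellCovered_jetLift_iff {s : ℕ} {C : Clutter V} :
    (C.jetLift s).IsWellCovered ↔ C.IsWellCovered := by
  constructor
  · intro h W U hW hU
    have := h _ _ (isMinimalVertexCover_jetLift_jetSet.2 hW)
      (isMinimalVertexCover_jetLift_jetSet.2 hU)
    rw [card_jetSet, card_jetSet] at this
    exact Nat.eq_of_mul_eq_mul_right s.succ_pos this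
  · intro h W U hW hU
    obtain ⟨W', hW', rfl⟩ := isMinimalVertexCover_jetLift_iff.1 hW
    obtain ⟨U', hU', rfl⟩ := isMinimalVertexCover_jetLift_iff.1 hU
    rw [card_jetSet, card_jetSet, h W' U' hW' hU']

theorem forall_mul_card_jetLift_iff [Fintype V] {s : ℕ} {C : Clutter V} {d : ℕ} :
    (∀ U, (C.jetLift s).IsMinimalVertexCover U → d * U.card = Fintype.card (V × Fin (s + 1))) ↔
      ∀ W, C.IsMinimalVertexCover W → d * W.card = Fintype.card V := by
  have key (W : Finset V) : d * (Jets.jetSet s W).card = Fintype.card (V × Fin (s + 1)) ↔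
      d * W.card = Fintype.card V := by
    rw [card_jetSet, Fintype.card_prod, Fintype.card_fin, ← mul_assoc]
    exact Nat.mul_left_inj s.succ_ne_zero
  simp only [isMinimalVertexCover_jetLift_iff, forall_exists_index, and_imp,
    forall_apply_eq_imp_iff₂, key]

end Jets

end Clutter

namespace Clutter

open MvPolynomial

/-! ### Smooth points of edge ideal schemes -/

section Smooth

variable {V : Type*} {k : Type*} [Field k]

/-- If `L` is the residue field of affine space at the generic point of a coordinate subspace,
then `L` is formally smooth over `k`. -/
theorem formallySmooth_of_varIdeal {W : Finset V} {L : Type*} [CommRing L] [Nontrivial L]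
    [Algebra k L] (θ : MvPolynomial V k →ₐ[k] L) (hunit : ∀ f ∉ varIdeal k W, IsUnit (θ f))
    (hzero : ∀ f ∈ varIdeal k W, θ f = 0)
    (hsurj : ∀ z, ∃ a, ∃ b ∉ varIdeal k W, z * θ b = θ a) : Algebra.FormallySmooth k L := by
  have hkill (f : MvPolynomial V k) : θ f = θ (rename Subtype.val (killVars k W f)) := by
    rw [← sub_eq_zero, ← map_sub]
    exact hzero _ (sub_rename_killVars_mem W f)
  let η : MvPolynomial {x // x ∉ W} k →ₐ[k] L := θ.comp (rename Subtype.val)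
  have hren {f : MvPolynomial {x // x ∉ W} k} (hf : f ≠ 0) :
      rename Subtype.val f ∉ varIdeal k W := by
    rw [← ker_killVars, RingHom.mem_ker, killVars, killCompl_rename_app]
    exact hf
  have hkill_ne {f : MvPolynomial V k} (hf : f ∉ varIdeal k W) : killVars k W f ≠ 0 := fun h =>
    hf (by rwa [← ker_killVars, RingHom.mem_ker])
  let : Algebra (MvPolynomial {x // x ∉ W} k) L := η.toRingHom.toAlgebra
  have halg (f : MvPolynomial {x // x ∉ W} k) : algebraMap _ L f = θ (rename Subtype.val f) := rfl
  have : IsScalarTower k (MvPolynomial {x // x ∉ W} k) L :=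
    IsScalarTower.of_algebraMap_eq fun c => (η.commutes c).symm
  -- `L` is the fraction field of the polynomial ring in the variables outside `W`.
  have : IsLocalization (nonZeroDivisors (MvPolynomial {x // x ∉ W} k)) L := by
    refine ⟨fun y => hunit _ (hren (nonZeroDivisors.coe_ne_zero y)), fun z => ?_,
      fun {a b} hab => ?_⟩
    · obtain ⟨a, b, hb, hab⟩ := hsurj z
      refine ⟨⟨killVars k W a, killVars k W b, mem_nonZeroDivisors_of_ne_zero (hkill_ne hb)⟩, ?_⟩
      simpa only [halg, ← hkill] using hab
    · refine ⟨1, ?_⟩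
      by_contra hne
      have hne' : a - b ≠ 0 := fun h => hne (by rw [sub_eq_zero.1 h])
      have := hunit _ (hren hne')
      rw [map_sub, map_sub, ← halg, ← halg, hab, sub_self] at this
      exact not_isUnit_zero this
  have : Algebra.FormallySmooth (MvPolynomial {x // x ∉ W} k) L :=
    Algebra.FormallySmooth.of_isLocalization (nonZeroDivisors (MvPolynomial {x // x ∉ W} k))
  exact Algebra.FormallySmooth.comp k (MvPolynomial {x // x ∉ W} k) L

/-- A subscheme of affine space is smooth at the generic point of a coordinate subspace if it
agrees with that subspace near this point. -/
theorem isSmoothAt_of_comap_eq_varIdeal {J : Ideal (MvPolynomial V k)} {W : Finset V}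
    (hJ : ∀ x ∈ W, ∃ g ∉ varIdeal k W, X x * g ∈ J)
    (p : Ideal (MvPolynomial V k ⧸ J)) [p.IsPrime]
    (hp : p.comap (Ideal.Quotient.mk J) = varIdeal k W) : Algebra.IsSmoothAt k p := by
  have hmem (f : MvPolynomial V k) : Ideal.Quotient.mk J f ∈ p ↔ f ∈ varIdeal k W := by
    rw [← hp, Ideal.mem_comap]
  let θ : MvPolynomial V k →ₐ[k] Localization.AtPrime p :=
    (IsScalarTower.toAlgHom k (MvPolynomial V k ⧸ J) _).comp (Ideal.Quotient.mkₐ k J)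
  have hθ (f : MvPolynomial V k) : θ f = algebraMap _ _ (Ideal.Quotient.mk J f) := rfl
  have hunit (f) (hf : f ∉ varIdeal k W) : IsUnit (θ f) :=
    IsLocalization.map_units _ (⟨Ideal.Quotient.mk J f, (hmem f).not.2 hf⟩ : p.primeCompl)
  have hzero : varIdeal k W ≤ RingHom.ker θ := by
    refine varIdeal_le_iff.2 fun x hx => ?_
    obtain ⟨g, hg, hxg⟩ := hJ x hx
    have h0 : θ (X x) * θ g = 0 := by
      rw [← map_mul, hθ, Ideal.Quotient.eq_zero_iff_mem.2 hxg, map_zero]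
    exact (hunit g hg).mul_left_eq_zero.1 h0
  refine formallySmooth_of_varIdeal θ hunit (fun f hf => hzero hf) fun z => ?_
  obtain ⟨⟨a, b, hb⟩, hab⟩ := IsLocalization.surj p.primeCompl z
  obtain ⟨a, rfl⟩ := Ideal.Quotient.mk_surjective a
  obtain ⟨b, rfl⟩ := Ideal.Quotient.mk_surjective b
  exact ⟨a, b, (hmem b).not.1 hb, hab⟩

/-- A polynomial with nonzero constant term is coprime to every power of the variable. -/
theorem isUnit_mk_span_X_pow {κ : Type*} [Field κ] {f : Polynomial κ} (hf : f.eval 0 ≠ 0) (n : ℕ) :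
    IsUnit (Ideal.Quotient.mk (Ideal.span {(Polynomial.X : Polynomial κ) ^ n}) f) := by
  have hcop : IsCoprime f (Polynomial.X ^ n) := by
    refine IsCoprime.pow_right (IsCoprime.symm ?_)
    rw [Polynomial.irreducible_X.coprime_iff_not_dvd, Polynomial.X_dvd_iff,
      Polynomial.coeff_zero_eq_eval_zero]
    exact hf
  obtain ⟨a, b, hab⟩ := hcop
  refine IsUnit.of_mul_eq_one (Ideal.Quotient.mk _ a) ?_
  rw [← map_mul, ← map_one (Ideal.Quotient.mk _), Ideal.Quotient.eq, Ideal.mem_span_singleton]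
  exact ⟨-b, by linear_combination hab⟩

theorem isNilpotent_ideal_of_mul_eq_zero {A : Type*} [CommRing A] {I : Ideal A}
    (h : ∀ a ∈ I, ∀ b ∈ I, a * b = 0) : IsNilpotent I :=
  ⟨2, by rw [pow_two, Ideal.zero_eq_bot, ← le_bot_iff, Ideal.mul_le]; exact h⟩

/-- Formally smooth local algebras lift maps to truncated polynomial rings. -/
theorem exists_lift_truncated_of_isSmoothAt {R κ : Type*} [CommRing R] [Algebra k R] [Field κ]
    [Algebra k κ] {J : Ideal R} (p : Ideal (R ⧸ J)) [p.IsPrime] (hs : Algebra.IsSmoothAt k p)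
    {r : ℕ} (hr : 1 ≤ r) (ψ : R →ₐ[k] Polynomial κ)
    (hψJ : ∀ f ∈ J, Polynomial.X ^ r ∣ ψ f)
    (hψp : ∀ f, Ideal.Quotient.mk J f ∉ p → (ψ f).eval 0 ≠ 0) :
    ∃ h : R →ₐ[k] Polynomial κ ⧸ Ideal.span {(Polynomial.X : Polynomial κ) ^ (r + 1)},
      (∀ f ∈ J, h f = 0) ∧ ∀ f, ∃ c, h f = Ideal.Quotient.mk _ (ψ f + Polynomial.X ^ r * c) := by
  let K (n : ℕ) : Ideal (Polynomial κ) := Ideal.span {Polynomial.X ^ n}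
  have hK : K (r + 1) ≤ K r := by
    rw [Ideal.span_singleton_le_span_singleton]
    exact pow_dvd_pow _ r.le_succ
  let φ : R ⧸ J →ₐ[k] Polynomial κ ⧸ K r :=
    Ideal.Quotient.liftₐ J ((Ideal.Quotient.mkₐ k (K r)).comp ψ) fun f hf =>
      Ideal.Quotient.eq_zero_iff_mem.2 (Ideal.mem_span_singleton.2 (hψJ f hf))
  have hφ (f : R) : φ (Ideal.Quotient.mk J f) = Ideal.Quotient.mk (K r) (ψ f) := rfl
  have hφu (y : p.primeCompl) : IsUnit (φ y) := by
    obtain ⟨y, hy⟩ := y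
    obtain ⟨y, rfl⟩ := Ideal.Quotient.mk_surjective y
    exact isUnit_mk_span_X_pow (hψp y hy) r
  let φ' : Localization.AtPrime p →ₐ[k] Polynomial κ ⧸ K r :=
    IsLocalization.liftAlgHom (M := p.primeCompl) hφu
  let q : Polynomial κ ⧸ K (r + 1) →ₐ[k] Polynomial κ ⧸ K r := Ideal.Quotient.factorₐ k hK
  have hq (f : Polynomial κ) : q (Ideal.Quotient.mk _ f) = Ideal.Quotient.mk _ f := rfl
  have hqsurj : Function.Surjective q := Ideal.Quotient.factor_surjective hK
  have hqker (a) (ha : q a = 0) : ∃ c, a = Ideal.Quotient.mk _ (Polynomial.X ^ r * c) := by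
    obtain ⟨a, rfl⟩ := Ideal.Quotient.mk_surjective a
    rw [hq, Ideal.Quotient.eq_zero_iff_mem, Ideal.mem_span_singleton] at ha
    obtain ⟨c, rfl⟩ := ha
    exact ⟨c, rfl⟩
  have hnil : IsNilpotent (RingHom.ker (q : Polynomial κ ⧸ K (r + 1) →+* Polynomial κ ⧸ K r)) := by
    refine isNilpotent_ideal_of_mul_eq_zero fun a ha b hb => ?_
    obtain ⟨a, rfl⟩ := hqker a ha
    obtain ⟨b, rfl⟩ := hqker b hb
    rw [← map_mul, Ideal.Quotient.eq_zero_iff_mem, Ideal.mem_span_singleton]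
    -- Since `r ≥ 1`, `2 * r ≥ r + 1`, so the kernel squares to zero.
    obtain ⟨r, rfl⟩ := Nat.exists_eq_add_of_le' hr
    exact ⟨Polynomial.X ^ r * a * b, by ring⟩
  have : Algebra.FormallySmooth k (Localization.AtPrime p) := hs
  let H := Algebra.FormallySmooth.liftOfSurjective φ' q hqsurj hnil
  have hH (a) : q (H a) = φ' a :=
    Algebra.FormallySmooth.liftOfSurjective_apply φ' q hqsurj hnil a
  refine ⟨(H.comp (IsScalarTower.toAlgHom k (R ⧸ J) _)).comp (Ideal.Quotient.mkₐ k J),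
    fun f hf => ?_, fun f => ?_⟩
  · change H (algebraMap _ _ (Ideal.Quotient.mk J f)) = 0
    rw [Ideal.Quotient.eq_zero_iff_mem.2 hf, map_zero, map_zero]
  · change ∃ c, H (algebraMap _ _ (Ideal.Quotient.mk J f)) = _
    have h1 : q (H (algebraMap _ _ (Ideal.Quotient.mk J f)) - Ideal.Quotient.mk _ (ψ f)) = 0 := by
      rw [map_sub, hH, hq, ← hφ, sub_eq_zero]
      exact IsLocalization.lift_eq _ _
    obtain ⟨c, hc⟩ := hqker _ h1
    exact ⟨c, by rw [map_add, ← hc]; ring⟩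

/-- At a smooth point of the scheme of an edge ideal, every edge contains a vertex `x` that vanishes
at the point and is the only vertex to do so of some edge. -/
theorem exists_edge_of_isSmoothAt {C : Clutter V}
    (p : Ideal (MvPolynomial V k ⧸ C.edgeIdeal k)) [p.IsPrime] (hs : Algebra.IsSmoothAt k p)
    {P : Ideal (MvPolynomial V k)} (hP : p.comap (Ideal.Quotient.mk _) = P)
    {e : Finset V} (he : e ∈ C.edges) :
    ∃ x ∈ e, X x ∈ P ∧ ∃ f ∈ C.edges, x ∈ f ∧ ∀ y ∈ f, X y ∈ P → y = x := by
  classical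
  have hPprime : P.IsPrime := hP ▸ inferInstance
  have hJP : C.edgeIdeal k ≤ P := by
    intro u hu
    rw [← hP, Ideal.mem_comap, Ideal.Quotient.eq_zero_iff_mem.2 hu]
    exact p.zero_mem
  let tr (f : Finset V) : Finset V := f.filter fun x => X x ∈ P
  -- The trace of an edge is its set of vertices vanishing at `P`. A minimal trace `B` inside that
  -- of `e` settles the claim if it is a singleton; the rest excludes `r + 1 ≥ 2` elements.
  obtain ⟨B, ⟨⟨f, hf, hfB⟩, hBe⟩, hBmin⟩ : ∃ B, Minimal
      (fun B => (∃ f ∈ C.edges, tr f = B) ∧ B ⊆ tr e) B := by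
    obtain ⟨B, -, hB⟩ := exists_minimal_le_of_wellFoundedLT
      (fun B => (∃ f ∈ C.edges, tr f = B) ∧ B ⊆ tr e) (tr e) ⟨⟨e, he, rfl⟩, subset_rfl⟩
    exact ⟨B, hB⟩
  have hBP {x : V} (hx : x ∈ B) : X x ∈ P := by
    rw [← hfB] at hx
    exact (Finset.mem_filter.1 hx).2
  have hBf : B ⊆ f := hfB ▸ Finset.filter_subset _ f
  have hmem {x : V} (hx : x ∈ f) (hxP : X x ∈ P) : x ∈ B := hfB ▸ Finset.mem_filter.2 ⟨hx, hxP⟩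
  have hBne : B.Nonempty := by
    obtain ⟨x, hx, hxP⟩ := hPprime.prod_mem_iff.1 (hJP (Ideal.subset_span ⟨f, hf, rfl⟩))
    exact ⟨x, hmem hx hxP⟩
  obtain ⟨r, hr⟩ : ∃ r, B.card = r + 1 := Nat.exists_eq_succ_of_ne_zero hBne.card_pos.ne'
  obtain rfl | hr0 := Nat.eq_zero_or_pos r
  · obtain ⟨x, rfl⟩ := Finset.card_eq_one.1 hr
    have hx := Finset.mem_singleton_self x
    exact ⟨x, (Finset.mem_filter.1 (hBe hx)).1, hBP hx, f, hf, hBf hx,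
      fun y hy hyP => Finset.mem_singleton.1 (hmem hy hyP)⟩
  exfalso
  let κ := P.ResidueField
  -- The arc through `P` that moves the coordinates in `B` with unit speed and keeps the others
  -- constant.
  let ψ : MvPolynomial V k →ₐ[k] Polynomial κ :=
    aeval fun x => if x ∈ B then Polynomial.X else Polynomial.C (algebraMap (MvPolynomial V k) κ (X x))
  have hψB {x : V} (hx : x ∈ B) : ψ (X x) = Polynomial.X := by simp [ψ, hx]
  have hψC {x : V} (hx : x ∉ B) : ψ (X x) = Polynomial.C (algebraMap (MvPolynomial V k) κ (X x)) := by
    simp [ψ, hx]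
  have hψ0 (u : MvPolynomial V k) : (ψ u).eval 0 = algebraMap _ κ u := by
    suffices h : ((Polynomial.aeval (0 : κ)).restrictScalars k).comp ψ =
        IsScalarTower.toAlgHom k (MvPolynomial V k) κ from DFunLike.congr_fun h u
    refine algHom_ext fun x => ?_
    by_cases hx : x ∈ B
    · simpa [hψB hx] using (Ideal.algebraMap_residueField_eq_zero.2 (hBP hx)).symm
    · simp [hψC hx]
  have hψJ : ∀ u ∈ C.edgeIdeal k, Polynomial.X ^ (r + 1) ∣ ψ u := by
    suffices h : C.edgeIdeal k ≤ (Ideal.span {Polynomial.X ^ (r + 1)}).comap ψ from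
      fun u hu => Ideal.mem_span_singleton.1 (h hu)
    rw [edgeIdeal, Ideal.span_le]
    rintro _ ⟨f', hf', rfl⟩
    rw [SetLike.mem_coe, Ideal.mem_comap, Ideal.mem_span_singleton, map_prod]
    -- If the trace lies in `B`, minimality makes it equal to `B`, giving `r + 1` factors `t`.
    -- Otherwise a vertex outside `B` vanishes at `P` and contributes a zero factor.
    by_cases hle : tr f' ⊆ B
    · have hBf' : B ⊆ f' :=
        (hBmin ⟨⟨f', hf', rfl⟩, hle.trans hBe⟩ hle).trans (Finset.filter_subset _ f')
      have hpow : ∏ x ∈ B, ψ (X x) = Polynomial.X ^ (r + 1) := by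
        rw [Finset.prod_congr rfl fun x hx => hψB hx, Finset.prod_const, hr]
      rw [← hpow]
      exact Finset.prod_dvd_prod_of_subset _ _ _ hBf'
    · obtain ⟨x, hx, hxB⟩ := Finset.not_subset.1 hle
      obtain ⟨hx, hxP⟩ := Finset.mem_filter.1 hx
      rw [Finset.prod_eq_zero hx]
      · exact dvd_zero _
      · rw [hψC hxB, Ideal.algebraMap_residueField_eq_zero.2 hxP, map_zero]
  obtain ⟨h, hJ, hc⟩ := exists_lift_truncated_of_isSmoothAt p hs (Nat.le_add_left 1 r) ψ hψJ
    fun u hu => by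
      rw [hψ0, Ne, Ideal.algebraMap_residueField_eq_zero, ← hP]
      exact hu
  choose c hc using fun x => hc (X x)
  have hprod : Polynomial.X ^ (r + 1 + 1) ∣
      ∏ x ∈ f, (ψ (X x) + Polynomial.X ^ (r + 1) * c x) := by
    rw [← Ideal.mem_span_singleton, ← Ideal.Quotient.eq_zero_iff_mem, map_prod]
    simp only [← hc]
    rw [← map_prod]
    exact hJ _ (Ideal.subset_span ⟨f, hf, rfl⟩)
  have hB : ∏ x ∈ B, (ψ (X x) + Polynomial.X ^ (r + 1) * c x) =
      Polynomial.X ^ (r + 1) * ∏ x ∈ B, (1 + Polynomial.X ^ r * c x) := by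
    have hpow : Polynomial.X ^ (r + 1) = ∏ _x ∈ B, (Polynomial.X : Polynomial κ) := by
      rw [Finset.prod_const, hr]
    conv_rhs => rw [hpow, ← Finset.prod_mul_distrib]
    refine Finset.prod_congr rfl fun x hx => ?_
    rw [hψB hx]
    ring
  -- After cancelling `t ^ (r + 1)`, the product over `f` should vanish at `t = 0`. But the factors
  -- outside `B` are nonzero at `P`, and those in `B` become `1` because `r > 0`.
  rw [← Finset.prod_sdiff hBf, hB, pow_succ, mul_left_comm,
    mul_dvd_mul_iff_left (pow_ne_zero _ Polynomial.X_ne_zero), Polynomial.X_dvd_iff,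
    Polynomial.coeff_zero_eq_eval_zero, Polynomial.eval_mul, Polynomial.eval_prod,
    Polynomial.eval_prod] at hprod
  refine mul_ne_zero (Finset.prod_ne_zero_iff.2 fun x hx => ?_)
    (Finset.prod_ne_zero_iff.2 fun x _ => ?_) hprod
  · obtain ⟨hxf, hxB⟩ := Finset.mem_sdiff.1 hx
    have hne : algebraMap (MvPolynomial V k) κ (X x) ≠ 0 := fun h =>
      hxB (hmem hxf (Ideal.algebraMap_residueField_eq_zero.1 h))
    simpa [hψC hxB] using hne
  · simp [hr0.ne']

end Smooth

end Clutter

/-! ### Jets over smooth points and the ideal of principal jets -/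

namespace Jets

open MvPolynomial Clutter

variable {V : Type*} {k : Type*} [Field k]

theorem jetHom_X (s : ℕ) (x : V) : jetHom k V s (X x) =
    ∑ j : Fin (s + 1), Polynomial.C (X (x, j)) * Polynomial.X ^ (j : ℕ) := by
  simp [jetHom]

theorem coeff_jetHom_X {s : ℕ} (x : V) (j : Fin (s + 1)) :
    (jetHom k V s (X x)).coeff j = X (x, j) := by
  simp [jetHom_X, Polynomial.coeff_X_pow, ← Fin.ext_iff]

theorem coeff_zero_jetHom {s : ℕ} (f : MvPolynomial V k) :
    (jetHom k V s f).coeff 0 = jetInclusion k V s f := by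
  rw [Polynomial.coeff_zero_eq_eval_zero]
  suffices h : ((Polynomial.aeval (0 : MvPolynomial (V × Fin (s + 1)) k)).restrictScalars k).comp
      (jetHom k V s) = jetInclusion k V s from DFunLike.congr_fun h f
  refine algHom_ext fun x => ?_
  have := coeff_jetHom_X (k := k) x (0 : Fin (s + 1))
  rw [Fin.val_zero, Polynomial.coeff_zero_eq_eval_zero] at this
  simpa [jetInclusion] using this

theorem jetIdeal_le_iff {s : ℕ} {I : Ideal (MvPolynomial V k)}
    {Q : Ideal (MvPolynomial (V × Fin (s + 1)) k)} :
    jetIdeal s I ≤ Q ↔ ∀ f ∈ I, ∀ j ≤ s, (jetHom k V s f).coeff j ∈ Q := by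
  rw [jetIdeal, Ideal.span_le]
  exact ⟨fun h f hf j hj => h ⟨f, hf, j, hj, rfl⟩,
    fun h g ⟨f, hf, j, hj, hg⟩ => hg ▸ h f hf j hj⟩

theorem jetIdeal_varIdeal_le {s : ℕ} {W : Finset V} :
    jetIdeal s (varIdeal k W) ≤ varIdeal k (jetSet s W) := by
  have h : varIdeal k W ≤
      ((varIdeal k (jetSet s W)).map Polynomial.C).comap (jetHom k V s) := by
    refine varIdeal_le_iff.2 fun x hx => ?_
    rw [Ideal.mem_comap, jetHom_X]
    refine Ideal.sum_mem _ fun j _ => Ideal.mul_mem_right _ _ (Ideal.mem_map_of_mem _ ?_)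
    exact X_mem_varIdeal.2 (Finset.mem_product.2 ⟨hx, Finset.mem_univ j⟩)
  exact jetIdeal_le_iff.2 fun f hf j _ => Ideal.mem_map_C_iff.1 (h hf) j

theorem jetIdeal_mono {s : ℕ} {I J : Ideal (MvPolynomial V k)} (h : I ≤ J) :
    jetIdeal s I ≤ jetIdeal s J :=
  jetIdeal_le_iff.2 fun f hf j hj => Ideal.subset_span ⟨f, h hf, j, hj, rfl⟩

theorem comap_jetInclusion_varIdeal (s : ℕ) (W : Finset V) :
    (varIdeal k (jetSet s W)).comap (jetInclusion k V s) = varIdeal k W := by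
  refine le_antisymm (fun f hf => ?_) (varIdeal_le_iff.2 fun x hx => ?_)
  · let ρ : MvPolynomial (V × Fin (s + 1)) k →ₐ[k] MvPolynomial V k :=
      aeval fun a => if a.2 = 0 then X a.1 else 0
    have hρ : ρ.comp (jetInclusion k V s) = AlgHom.id k _ :=
      algHom_ext fun x => by simp [ρ, jetInclusion]
    have hle : varIdeal k (jetSet s W) ≤ (varIdeal k W).comap ρ := by
      refine varIdeal_le_iff.2 fun a ha => ?_
      rw [Ideal.mem_comap, aeval_X]
      split_ifs
      · exact X_mem_varIdeal.2 (Finset.mem_product.1 ha).1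
      · exact zero_mem _
    have := hle hf
    rwa [Ideal.mem_comap, ← AlgHom.comp_apply, hρ] at this
  · rw [Ideal.mem_comap, jetInclusion, rename_X]
    exact X_mem_varIdeal.2 (Finset.mem_product.2 ⟨hx, Finset.mem_univ _⟩)

/-- If a multiple of the variable `x` by a function not vanishing at the base point of a jet lies
in the ideal, then all the coordinates `x_j` of the jet vanish. -/
theorem X_mem_of_X_mul_mem {s : ℕ} {I : Ideal (MvPolynomial V k)}
    {Q : Ideal (MvPolynomial (V × Fin (s + 1)) k)} [Q.IsPrime] (hQ : jetIdeal s I ≤ Q)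
    {x : V} {g : MvPolynomial V k} (hg : jetInclusion k V s g ∉ Q) (hxg : X x * g ∈ I)
    (j : Fin (s + 1)) : X (x, j) ∈ Q := by
  -- Strong induction on the order: the coefficient of `t ^ n` in the image of `x * g` is `x_n *
  -- g_0` plus terms containing some `x_i` with `i < n`. As `g_0 ∉ Q`, primality gives `x_n ∈ Q`.
  suffices h : ∀ n ≤ s, (jetHom k V s (X x)).coeff n ∈ Q by
    rw [← coeff_jetHom_X x j]
    exact h j (Nat.lt_succ_iff.1 j.2)
  intro n
  induction n using Nat.strong_induction_on with
  | _ n ih =>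
    intro hn
    have h := jetIdeal_le_iff.1 hQ _ hxg n hn
    rw [map_mul, Polynomial.coeff_mul, ← Finset.add_sum_erase _ _
      (Finset.HasAntidiagonal.mem_antidiagonal.2 (add_zero n) :
        (n, 0) ∈ Finset.HasAntidiagonal.antidiagonal n), Ideal.add_mem_iff_left,
      coeff_zero_jetHom] at h
    · exact (‹Q.IsPrime›.mem_or_mem h).resolve_right hg
    · refine Ideal.sum_mem _ fun a ha => Ideal.mul_mem_right _ _ (ih a.1 ?_ ?_)
      all_goals
        obtain ⟨hne, ha⟩ := Finset.mem_erase.1 ha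
        rw [Finset.HasAntidiagonal.mem_antidiagonal] at ha
      · refine lt_of_le_of_ne (by omega) fun h => hne (Prod.ext h ?_)
        change a.2 = 0
        omega
      · omega

theorem principalJetIdeal_edgeIdeal [Finite V] (s : ℕ) (C : Clutter V) :
    principalJetIdeal s (C.edgeIdeal k) = (C.jetLift s).edgeIdeal k := by
  rw [principalJetIdeal, PrimeSpectrum.vanishingIdeal_closure, jetLocus, singularLocus,
    vanishingIdeal_zeroLocus_edgeIdeal, edgeIdeal_eq_iInf k (C.jetLift s)]
  apply le_antisymm
  · refine le_iInf₂ fun U hU f hf => ?_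
    obtain ⟨W, hW, rfl⟩ := isMinimalVertexCover_jetLift_iff.1 hU
    rw [PrimeSpectrum.mem_vanishingIdeal] at hf
    -- The point used is generic among the jets lying in the component of `W`.
    refine hf ⟨varIdeal k (jetSet s W), inferInstance⟩ ⟨?_, ?_⟩
    · exact (jetIdeal_mono ((edgeIdeal_le_varIdeal_iff k).2 hW.1)).trans jetIdeal_varIdeal_le
    · rintro ⟨p, hp, hpW⟩
      refine hp (isSmoothAt_of_comap_eq_varIdeal (W := W) (fun x hx => ?_) p.asIdeal ?_)
      · obtain ⟨e, he, hxe, hxW⟩ := hW.exists_edge hx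
        exact exists_X_mul_mem_edgeIdeal k he hxe fun y hy hyW => hxW y hy (X_mem_varIdeal.1 hyW)
      · exact (congrArg PrimeSpectrum.asIdeal hpW).trans (comap_jetInclusion_varIdeal s W)
  · intro f hf
    rw [PrimeSpectrum.mem_vanishingIdeal]
    rintro ⟨Q, hQprime⟩ ⟨hQ, hsmooth⟩
    replace hQ : jetIdeal s (C.edgeIdeal k) ≤ Q := hQ
    let P : Ideal (MvPolynomial V k) := Q.comap (jetInclusion k V s)
    have hJP : C.edgeIdeal k ≤ P := fun g hg => by
      rw [Ideal.mem_comap, ← coeff_zero_jetHom]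
      exact jetIdeal_le_iff.1 hQ g hg 0 (Nat.zero_le s)
    have hker : RingHom.ker (Ideal.Quotient.mk (C.edgeIdeal k)) ≤ P := by
      rwa [Ideal.mk_ker]
    have hp : (P.map (Ideal.Quotient.mk (C.edgeIdeal k))).IsPrime :=
      Ideal.map_isPrime_of_surjective Ideal.Quotient.mk_surjective hker
    have hcomap : (P.map (Ideal.Quotient.mk (C.edgeIdeal k))).comap (Ideal.Quotient.mk _) = P := by
      rw [Ideal.comap_map_of_surjective' _ Ideal.Quotient.mk_surjective, sup_eq_left]
      exact hker
    have hs : Algebra.IsSmoothAt k (P.map (Ideal.Quotient.mk (C.edgeIdeal k))) := by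
      by_contra hns
      exact hsmooth ⟨⟨_, hp⟩, hns, PrimeSpectrum.ext hcomap⟩
    classical
    have := Fintype.ofFinite V
    -- The vertices that vanish at `P` and are alone in doing so on some edge; smoothness makes them
    -- a cover.
    let W : Finset V := Finset.univ.filter fun x =>
      X x ∈ P ∧ ∃ e ∈ C.edges, x ∈ e ∧ ∀ y ∈ e, X y ∈ P → y = x
    have hW : C.IsVertexCover W := fun e he =>
      let ⟨x, hx, h⟩ := exists_edge_of_isSmoothAt _ hs hcomap he
      ⟨x, hx, Finset.mem_filter.2 ⟨Finset.mem_univ x, h⟩⟩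
    obtain ⟨U, hUW, hU⟩ := hW.exists_isMinimalVertexCover_subset
    simp only [Submodule.mem_iInf] at hf
    refine varIdeal_le_iff.2 (fun a ha => ?_)
      (hf (jetSet s U) (isMinimalVertexCover_jetLift_jetSet.2 hU))
    obtain ⟨-, -, e, he, hxe, hxP⟩ := Finset.mem_filter.1 (hUW (Finset.mem_product.1 ha).1)
    obtain ⟨g, hg, hxg⟩ := exists_X_mul_mem_edgeIdeal k he hxe hxP
    exact X_mem_of_X_mul_mem hQ hg hxg a.2

end Jets

/-! ### The clutter of principal jets -/

theorem Clutter.principalJets_eq_jetLift (k : Type*) [Field k] {V : Type*} [Finite V] (s : ℕ)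
    (C : Clutter V) : C.principalJets k s = C.jetLift s := by
  rw [principalJets, Jets.principalJetIdeal_edgeIdeal, ofIdeal_edgeIdeal]

theorem mainTheorem11 (k : Type*) [Field k] {V : Type*} [Fintype V] (C : Clutter V) :
    (∀ s : ℕ,
      (C.principalJets k s).edgeIdeal k = Jets.principalJetIdeal s (C.edgeIdeal k) ∧
      {U | (C.principalJets k s).IsMinimalVertexCover U} =
        Jets.jetSet s '' {W | C.IsMinimalVertexCover W}) ∧
    (C.IsWellCovered ↔ ∀ s : ℕ, (C.principalJets k s).IsWellCovered) ∧
    (C.IsVeryWellCovered ↔ ∀ s : ℕ, (C.principalJets k s).IsVeryWellCovered) ∧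
    (∀ d : ℕ, C.IsUniformVeryWellCovered d ↔
      ∀ s : ℕ, (C.principalJets k s).IsUniformVeryWellCovered d) := by
  -- Each covering property passes between `C` and its lift for every single `s`, so the quantifier
  -- over `s` becomes vacuous.
  simp only [Clutter.principalJets_eq_jetLift, Clutter.IsVeryWellCovered,
    Clutter.IsUniformVeryWellCovered, Clutter.isWellCovered_jetLift_iff,
    Clutter.isUniform_jetLift_iff, Clutter.forall_mul_card_jetLift_iff, forall_const,
    and_true]
  exact fun s => ⟨(Jets.principalJetIdeal_edgeIdeal s C).symm,
    Clutter.setOf_isMinimalVertexCover_jetLift s C⟩
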